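/- Let $\mathcal P_N=\{P_1\otimes\dots\otimes P_N : P_j\in\{i^\ell Q: Q\in\{\mathbb 1,X,Y,Z\},\ \ell\in\{0,1,2,3\}\}\}$ be the $N$-qubit Pauli group and let the Clifford group be the set of unitaries $U$ on $N$ qubits with $U\mathcal P_N U^\dagger=\mathcal P_N$; a Clifford circuit is an element of the Clifford group. A Pauli-rotation gate is a unitary $e^{i\theta P}$ with $\theta\in\mathbb R$ and $P\in\mathcal P_N$ Hermitian. A circuit $C$ on $N\ge n$ qubits prepares the (possibly mixed) $n$-qubit state $\rho$ if $\rho$ is the partial trace of $C|0^N\rangle\langle 0^N|C^\dagger$ over all but $n$ of the qubits. Let $D=e^{-i\frac{\pi}{8}Y}$, and for $n\ge 1$ let $$\tilde{\mathcal H}_0^{(n)}=\frac1n\sum_{i=1}^n \big(D^\dagger|1\rangle\langle 1|D\big)_i\otimes \mathbb 1_{[n]\setminus\{i\}}$$ be the $D$-rotated zero Hamiltonian on $n$ qubits. Lemma. Let $n\ge 1$ and let $C$ be a circuit on $N\geq n$ qubits that consists of Clifford circuits and at most one Pauli-rotation gate. If $C$ prepares the pure $n$-qubit state $|\psi\rangle\langle\psi|$,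 then $$\langle\psi|\tilde{\mathcal H}_0^{(n)}|\psi\rangle\ \ge\ \Big(1-\frac1n\Big)\sin^2\Big(\frac{\pi}{8}\Big).$$ More generally, if $C$ prepares the $n$-qubit state $\rho$, then $\mathrm{Tr}[\rho\,\tilde{\mathcal H}_0^{(n)}]\ge(1-\frac1n)\sin^2(\frac{\pi}{8})$, and there is at most one qubit $i\in[n]$ whose reduced state $\rho_i=\mathrm{Tr}_{[n]\setminus\{i\}}[\rho]$ satisfies $\mathrm{Tr}[\rho_i\,\tilde{\mathcal H}_0^{(1)}]<\sin^2(\frac{\pi}{8})$. -/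

import Mathlib

open Matrix

noncomputable section

namespace Clifford

/-- Operators on `n` qubits, as matrices in the computational basis `|x⟩`, `x ∈ {0,1}ⁿ`. -/
abbrev Op (n : ℕ) : Type := Matrix (Fin n → Fin 2) (Fin n → Fin 2) ℂ

/-- The tensor product `M₁ ⊗ ⋯ ⊗ Mₙ` of single-qubit operators. -/
def tensor {n : ℕ} (M : Fin n → Matrix (Fin 2) (Fin 2) ℂ) : Op n :=
  Matrix.of fun x y => ∏ j, M j (x j) (y j)

/-- The operator `A_i ⊗ 1_{[n] ∖ {i}}`. -/
def onQubit {n : ℕ} (i : Fin n) (A : Matrix (Fin 2) (Fin 2) ℂ) : Op n :=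
  tensor (Function.update (fun _ => 1) i A)

def pauliX : Matrix (Fin 2) (Fin 2) ℂ := !![0, 1; 1, 0]

def pauliY : Matrix (Fin 2) (Fin 2) ℂ := !![0, -Complex.I; Complex.I, 0]

def pauliZ : Matrix (Fin 2) (Fin 2) ℂ := !![1, 0; 0, -1]

/-- The single-qubit Pauli group `{i^ℓ P | P ∈ {1, X, Y, Z}, ℓ ∈ {0, 1, 2, 3}}`. -/
def pauliGroupOne : Set (Matrix (Fin 2) (Fin 2) ℂ) :=
  {M | ∃ l : Fin 4, ∃ P ∈ ({1, pauliX, pauliY, pauliZ} : Set (Matrix (Fin 2) (Fin 2) ℂ)),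
    M = Complex.I ^ (l : ℕ) • P}

/-- The `n`-qubit Pauli group, consisting of the `n`-fold tensor products of elements of the
single-qubit Pauli group. -/
def pauliGroup (n : ℕ) : Set (Op n) :=
  {P | ∃ M : Fin n → Matrix (Fin 2) (Fin 2) ℂ, (∀ j, M j ∈ pauliGroupOne) ∧ P = tensor M}

/-- The `n`-qubit Clifford group: the unitaries which stabilize the Pauli group under
conjugation. -/
def cliffordGroup (n : ℕ) : Set (Op n) :=
  {U | U ∈ Matrix.unitaryGroup (Fin n → Fin 2) ℂ ∧
    (fun P => U * P * Uᴴ) '' pauliGroup n = pauliGroup n}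

/-- `e^{iθP}`. -/
def pauliRotation {n : ℕ} (θ : ℝ) (P : Op n) : Op n :=
  NormedSpace.exp ((Complex.I * (θ : ℂ)) • P)

/-- `IsCliffordRotationCircuit n t U`: the operator `U` is implemented by an `n`-qubit circuit
`C_t e^{iθ_t P_t} C_{t-1} ⋯ C_1 e^{iθ_1 P_1} C_0` made of Clifford circuits `C_j` and exactly `t`
Pauli-rotation gates. Being a gate, `e^{iθP}` is unitary, so `P` is a Hermitian element of the
Pauli group (its overall phase is `±1`). -/
inductive IsCliffordRotationCircuit (n : ℕ) : ℕ → Op n → Prop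
  | clifford (C : Op n) (hC : C ∈ cliffordGroup n) : IsCliffordRotationCircuit n 0 C
  | rotate (t : ℕ) (U C P : Op n) (θ : ℝ) (hU : IsCliffordRotationCircuit n t U)
      (hP : P ∈ pauliGroup n) (hPh : P.IsHermitian) (hC : C ∈ cliffordGroup n) :
      IsCliffordRotationCircuit n (t + 1) (C * pauliRotation θ P * U)

/-- The rank-one operator `|ψ⟩⟨ψ|`. -/
def ketbra {n : ℕ} (ψ : (Fin n → Fin 2) → ℂ) : Op n := Matrix.vecMulVec ψ (star ψ)

/-- The ket `|0⟩^{⊗n}`. -/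
def zeroKet (n : ℕ) : (Fin n → Fin 2) → ℂ := Pi.single (fun _ => 0) 1

/-- The partial trace of an `N`-qubit operator over all qubits outside the range of `e`, as an
operator on `k` qubits; the `j`-th remaining qubit is the qubit `e j` of the large system. -/
def reducedState {k N : ℕ} (e : Fin k ↪ Fin N) (ρ : Op N) : Op k :=
  Matrix.of fun x y => ∑ z : Fin N → Fin 2, ∑ w : Fin N → Fin 2,
    if (∀ j, z (e j) = x j) ∧ (∀ j, w (e j) = y j) ∧ (∀ i, (∀ j, e j ≠ i) → z i = w i)
    then ρ z w else 0

/-- The reduced state on the single qubit `i`. -/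
def qubitState {n : ℕ} (i : Fin n) (ρ : Op n) : Op 1 :=
  reducedState ⟨fun _ => i, fun _ _ _ => Subsingleton.elim _ _⟩ ρ

/-- The `N`-qubit circuit `C` prepares the (possibly mixed) `n`-qubit state `ρ` on its output
qubits `e 0, …, e (n - 1)`: `ρ` is obtained from `C |0^N⟩⟨0^N| C†` by tracing out the other
`N - n` qubits. -/
def Prepares {n N : ℕ} (e : Fin n ↪ Fin N) (C : Op N) (ρ : Op n) : Prop :=
  ρ = reducedState e (C * ketbra (zeroKet N) * Cᴴ)

/-- The single-qubit gate `D = e^{-iπ/8 Y}`. -/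
def gateD : Matrix (Fin 2) (Fin 2) ℂ :=
  NormedSpace.exp ((-(Complex.I * ((Real.pi / 8 : ℝ) : ℂ))) • pauliY)

/-- The projector `|1⟩⟨1|`. -/
def projOne : Matrix (Fin 2) (Fin 2) ℂ := !![0, 0; 0, 1]

/-- The `D`-rotated zero Hamiltonian `(1/n) ∑ᵢ (D† |1⟩⟨1| D)ᵢ ⊗ 1_{[n] ∖ {i}}`. -/
def rotatedZeroHamiltonian (n : ℕ) : Op n :=
  (1 / (n : ℂ)) • ∑ i : Fin n, onQubit i (gateDᴴ * projOne * gateD)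

/-- The energy `Tr[ρ H̃]` of a state under the `D`-rotated zero Hamiltonian (a real number, as
both operators are Hermitian). -/
def energy {n : ℕ} (ρ : Op n) : ℝ := (ρ * rotatedZeroHamiltonian n).trace.re

end Clifford

end

/-!
The terms of the Hamiltonian are `D†|1⟩⟨1|D = (1 + (X - Z)/√2)/2`, so a qubit has energy below
`sin²(π/8) = (1 - 1/√2)/2` exactly if its Bloch vector satisfies `z - x > 1`. It is enough to show
that this happens on at most one qubit (`Clifford.eq_of_one_lt_of_one_lt`): local energies are
nonnegative, so the average over `n` qubits is then at least `(1 - 1/n) sin²(π/8)`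
(`Clifford.sub_one_mul_le_sum`).

A Clifford operator can be moved past a rotation at the cost of conjugating its Pauli operator, so
the circuit prepares `e^{iθP}|φ⟩` with `|φ⟩` a stabilizer state
(`Clifford.IsCliffordRotationCircuit.exists_rotation`). In `|φ⟩` the Pauli observables have
expectations in `{0, 1, -1}`, and of two anticommuting ones at most one has nonzero expectation
(`Clifford.IsStabilizerState.expect_eq_zero_or`). After the rotation, a Pauli observable `S` that
commutes with `P` keeps its expectation, and one that anticommutes with `P` gets
`cos(2θ)⟨S⟩ - sin(2θ)⟨iPS⟩`. Going through the cases, `z - x > 1` on the qubit `a` requires that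
`P` anticommutes with `X_a` and `Z_a`, that `⟨S_a⟩ ≠ 0` for some `S ∈ {X, Z}`, and that
`⟨iPT_a⟩ ≠ 0` for some `T ∈ {X, Z}` (`Clifford.exists_anticommuting_of_one_lt`). If two qubits
`a ≠ b` were like this, then `S_a` and `iPT_b` would both have nonzero expectation in `|φ⟩`, but
they anticommute.
-/

noncomputable section

namespace Clifford

open scoped ComplexOrder

variable {n N : ℕ}

/-! ### Tensor products and operators on one qubit -/

theorem tensor_mul_tensor (M M' : Fin n → Matrix (Fin 2) (Fin 2) ℂ) :
    tensor M * tensor M' = tensor fun j => M j * M' j := by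
  ext x y
  simp only [tensor, Matrix.mul_apply, Matrix.of_apply, ← Finset.prod_mul_distrib]
  rw [Finset.prod_univ_sum, Fintype.piFinset_univ]

theorem tensor_conjTranspose (M : Fin n → Matrix (Fin 2) (Fin 2) ℂ) :
    (tensor M)ᴴ = tensor fun j => (M j)ᴴ := by
  ext x y
  simp [tensor, Matrix.conjTranspose_apply]

theorem tensor_one : tensor (fun _ : Fin n => 1) = 1 := by
  ext x y
  simp only [tensor, Matrix.of_apply, Matrix.one_apply, Finset.prod_ite_zero, funext_iff]
  simp

theorem onQubit_apply (i : Fin n) (A : Matrix (Fin 2) (Fin 2) ℂ) (x y : Fin n → Fin 2) :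
    onQubit i A x y = if ∀ j, j ≠ i → x j = y j then A (x i) (y i) else 0 := by
  simp only [onQubit, tensor, Matrix.of_apply]
  rw [← Finset.mul_prod_erase _ _ (Finset.mem_univ i), Function.update_self]
  rw [Finset.prod_congr rfl (g := fun j => if x j = y j then (1 : ℂ) else 0)]
  · rw [Finset.prod_ite_zero]
    simp
  · intro j hj
    rw [Function.update_of_ne (Finset.ne_of_mem_erase hj), Matrix.one_apply]

theorem onQubit_mul (i : Fin n) (A B : Matrix (Fin 2) (Fin 2) ℂ) :
    onQubit i A * onQubit i B = onQubit i (A * B) := by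
  rw [onQubit, onQubit, tensor_mul_tensor, onQubit]
  congr 1
  funext j
  by_cases h : j = i
  · subst h; simp
  · simp [Function.update_of_ne h]

theorem onQubit_conjTranspose (i : Fin n) (A : Matrix (Fin 2) (Fin 2) ℂ) :
    (onQubit i A)ᴴ = onQubit i Aᴴ := by
  rw [onQubit, tensor_conjTranspose, onQubit]
  congr 1
  funext j
  by_cases h : j = i
  · subst h; simp
  · simp [Function.update_of_ne h]

theorem onQubit_one (i : Fin n) : onQubit i 1 = 1 := by
  rw [onQubit, Function.update_eq_self_iff.mpr rfl, tensor_one]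

theorem onQubit_add (i : Fin n) (A B : Matrix (Fin 2) (Fin 2) ℂ) :
    onQubit i (A + B) = onQubit i A + onQubit i B := by
  ext x y
  simp only [Matrix.add_apply, onQubit_apply]
  split_ifs <;> simp

theorem onQubit_smul (i : Fin n) (c : ℂ) (A : Matrix (Fin 2) (Fin 2) ℂ) :
    onQubit i (c • A) = c • onQubit i A := by
  ext x y
  simp only [Matrix.smul_apply, onQubit_apply]
  split_ifs <;> simp

theorem onQubit_neg (i : Fin n) (A : Matrix (Fin 2) (Fin 2) ℂ) :
    onQubit i (-A) = -onQubit i A := by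
  simpa using onQubit_smul i (-1) A

theorem onQubit_commute {i j : Fin n} (h : i ≠ j) (A B : Matrix (Fin 2) (Fin 2) ℂ) :
    Commute (onQubit i A) (onQubit j B) := by
  rw [commute_iff_eq, onQubit, onQubit, tensor_mul_tensor, tensor_mul_tensor]
  congr 1
  funext k
  by_cases hi : k = i
  · subst hi; simp [Function.update_of_ne h]
  · simp [Function.update_of_ne hi]

/-- A single-qubit observable has the same expectation in the reduced state as in the large state,
where it acts on the qubit `e i`. -/
theorem trace_reducedState_mul_onQubit (e : Fin n ↪ Fin N) (ρ : Op N) (i : Fin n)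
    (A : Matrix (Fin 2) (Fin 2) ℂ) :
    (reducedState e ρ * onQubit i A).trace = (ρ * onQubit (e i) A).trace := by
  have key : ∀ z w : Fin N → Fin 2,
      (if ∀ k, (∀ j, e j ≠ k) → z k = w k then onQubit i A (w ∘ e) (z ∘ e) else 0) =
        onQubit (e i) A w z := by
    intro z w
    simp only [onQubit_apply, Function.comp_apply]
    by_cases h : ∀ j, j ≠ e i → w j = z j
    · rw [if_pos h, if_pos, if_pos]
      · exact fun j hj => h _ fun h' => hj (e.injective h')
      · exact fun k hk => (h k (hk i).symm).symm
    · rw [if_neg h]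
      split_ifs with h1 h2
      · refine absurd (fun k hk => ?_) h
        by_cases hr : ∃ j, e j = k
        · obtain ⟨j, rfl⟩ := hr
          exact h2 j fun h' => hk (h' ▸ rfl)
        · exact (h1 k (not_exists.mp hr)).symm
      · rfl
      · rfl
  simp only [Matrix.trace, Matrix.diag_apply, Matrix.mul_apply, reducedState, Matrix.of_apply,
    ← key, Finset.sum_mul]
  have swap : ∀ F : (Fin n → Fin 2) → (Fin n → Fin 2) → (Fin N → Fin 2) → (Fin N → Fin 2) → ℂ,
      ∑ x, ∑ y, ∑ z, ∑ w, F x y z w = ∑ z, ∑ w, ∑ x, ∑ y, F x y z w := by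
    intro F
    calc _ = ∑ x, ∑ z, ∑ y, ∑ w, F x y z w :=
          Finset.sum_congr rfl fun x _ => Finset.sum_comm
      _ = ∑ z, ∑ x, ∑ y, ∑ w, F x y z w := Finset.sum_comm
      _ = ∑ z, ∑ x, ∑ w, ∑ y, F x y z w :=
          Finset.sum_congr rfl fun z _ => Finset.sum_congr rfl fun x _ => Finset.sum_comm
      _ = _ := Finset.sum_congr rfl fun z _ => Finset.sum_comm
  rw [swap]
  refine Finset.sum_congr rfl fun z _ => Finset.sum_congr rfl fun w _ => ?_
  rw [Finset.sum_eq_single (z ∘ e), Finset.sum_eq_single (w ∘ e)]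
  · simp
  · intro y _ hy
    rw [if_neg, zero_mul]
    rintro ⟨-, h, -⟩
    exact hy (funext fun j => (h j).symm)
  · simp
  · intro x _ hx
    refine Finset.sum_eq_zero fun y _ => ?_
    rw [if_neg, zero_mul]
    rintro ⟨h, -, -⟩
    exact hx (funext fun j => (h j).symm)
  · simp

/-! ### The exponential of an involution -/

/-- Euler's formula for an involution `P`: the even powers in the exponential series are `1` and
the odd ones are `P`. -/
theorem exp_I_smul_of_mul_self {m : Type*} [Fintype m] [DecidableEq m] {P : Matrix m m ℂ}
    (hP : P * P = 1) (θ : ℝ) :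
    NormedSpace.exp ((Complex.I * (θ : ℂ)) • P) =
      (Real.cos θ : ℂ) • (1 : Matrix m m ℂ) + (Complex.I * Real.sin θ) • P := by
  have hexp : HasSum (fun k : ℕ => ((k.factorial : ℂ)⁻¹) • ((Complex.I * (θ : ℂ)) • P) ^ k)
      (NormedSpace.exp ((Complex.I * (θ : ℂ)) • P)) := by
    let _ : NormedRing (Matrix m m ℂ) := Matrix.linftyOpNormedRing
    let _ : NormedAlgebra ℂ (Matrix m m ℂ) := Matrix.linftyOpNormedAlgebra
    exact NormedSpace.exp_series_hasSum_exp' (𝕂 := ℂ) _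
  have hsq : ∀ k : ℕ, P ^ (2 * k) = 1 := fun k => by rw [pow_mul, sq, hP, one_pow]
  refine hexp.unique (HasSum.even_add_odd ?_ ?_)
  · have h := (Complex.hasSum_cos' (θ : ℂ)).smul_const (1 : Matrix m m ℂ)
    rw [← Complex.ofReal_cos] at h
    convert! h using 2 with k
    rw [smul_pow, hsq, smul_smul, mul_comm Complex.I, div_eq_inv_mul]
  · have h := ((Complex.hasSum_sin' (θ : ℂ)).mul_left Complex.I).smul_const P
    rw [← Complex.ofReal_sin] at h
    convert! h using 2 with k
    rw [smul_pow, pow_succ P, hsq, one_mul, smul_smul, mul_comm Complex.I (θ : ℂ),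
      mul_div_cancel₀ _ Complex.I_ne_zero, div_eq_inv_mul]

/-! ### The Pauli group -/

theorem pauliGroupOne_mul {A B : Matrix (Fin 2) (Fin 2) ℂ} (hA : A ∈ pauliGroupOne)
    (hB : B ∈ pauliGroupOne) : A * B ∈ pauliGroupOne := by
  obtain ⟨k, P, hP, rfl⟩ := hA
  obtain ⟨l, Q, hQ, rfl⟩ := hB
  have key : ∃ m : ℕ, ∃ R ∈ ({1, pauliX, pauliY, pauliZ} : Set (Matrix (Fin 2) (Fin 2) ℂ)),
      P * Q = Complex.I ^ m • R := by
    have hXX : pauliX * pauliX = Complex.I ^ 0 • 1 := by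
      ext i j; fin_cases i <;> fin_cases j <;> simp [pauliX]
    have hYY : pauliY * pauliY = Complex.I ^ 0 • 1 := by
      ext i j; fin_cases i <;> fin_cases j <;> simp [pauliY]
    have hZZ : pauliZ * pauliZ = Complex.I ^ 0 • 1 := by
      ext i j; fin_cases i <;> fin_cases j <;> simp [pauliZ]
    have hXY : pauliX * pauliY = Complex.I ^ 1 • pauliZ := by
      ext i j; fin_cases i <;> fin_cases j <;> simp [pauliX, pauliY, pauliZ]
    have hYZ : pauliY * pauliZ = Complex.I ^ 1 • pauliX := by
      ext i j; fin_cases i <;> fin_cases j <;> simp [pauliX, pauliY, pauliZ]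
    have hZX : pauliZ * pauliX = Complex.I ^ 1 • pauliY := by
      ext i j; fin_cases i <;> fin_cases j <;> simp [pauliX, pauliY, pauliZ]
    have hYX : pauliY * pauliX = Complex.I ^ 3 • pauliZ := by
      ext i j; fin_cases i <;> fin_cases j <;> simp [pauliX, pauliY, pauliZ]
    have hZY : pauliZ * pauliY = Complex.I ^ 3 • pauliX := by
      ext i j; fin_cases i <;> fin_cases j <;> simp [pauliX, pauliY, pauliZ]
    have hXZ : pauliX * pauliZ = Complex.I ^ 3 • pauliY := by
      ext i j; fin_cases i <;> fin_cases j <;> simp [pauliX, pauliY, pauliZ]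
    simp only [Set.mem_insert_iff, Set.mem_singleton_iff] at hP hQ
    rcases hP with rfl | rfl | rfl | rfl <;> rcases hQ with rfl | rfl | rfl | rfl
    · exact ⟨0, 1, by simp, by simp⟩
    · exact ⟨0, pauliX, by simp, by simp⟩
    · exact ⟨0, pauliY, by simp, by simp⟩
    · exact ⟨0, pauliZ, by simp, by simp⟩
    · exact ⟨0, pauliX, by simp, by simp⟩
    · exact ⟨0, 1, by simp, hXX⟩
    · exact ⟨1, pauliZ, by simp, hXY⟩
    · exact ⟨3, pauliY, by simp, hXZ⟩
    · exact ⟨0, pauliY, by simp, by simp⟩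
    · exact ⟨3, pauliZ, by simp, hYX⟩
    · exact ⟨0, 1, by simp, hYY⟩
    · exact ⟨1, pauliX, by simp, hYZ⟩
    · exact ⟨0, pauliZ, by simp, by simp⟩
    · exact ⟨1, pauliY, by simp, hZX⟩
    · exact ⟨3, pauliX, by simp, hZY⟩
    · exact ⟨0, 1, by simp, hZZ⟩
  obtain ⟨m, R, hR, h⟩ := key
  refine ⟨⟨(k + l + m) % 4, Nat.mod_lt _ (by norm_num)⟩, R, hR, ?_⟩
  rw [smul_mul_smul_comm, h, smul_smul, ← pow_add, ← pow_add, Complex.I_pow_eq_pow_mod]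

theorem pauliGroup_mul {P Q : Op n} (hP : P ∈ pauliGroup n) (hQ : Q ∈ pauliGroup n) :
    P * Q ∈ pauliGroup n := by
  obtain ⟨M, hM, rfl⟩ := hP
  obtain ⟨M', hM', rfl⟩ := hQ
  exact ⟨_, fun j => pauliGroupOne_mul (hM j) (hM' j), tensor_mul_tensor _ _⟩

theorem mem_pauliGroupOne {Q : Matrix (Fin 2) (Fin 2) ℂ}
    (hQ : Q ∈ ({1, pauliX, pauliY, pauliZ} : Set (Matrix (Fin 2) (Fin 2) ℂ))) :
    Q ∈ pauliGroupOne :=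
  ⟨0, Q, hQ, by simp⟩

theorem one_mem_pauliGroup : (1 : Op n) ∈ pauliGroup n :=
  ⟨fun _ => 1, fun _ => mem_pauliGroupOne (by simp), tensor_one.symm⟩

theorem onQubit_mem_pauliGroup (i : Fin n) {S : Matrix (Fin 2) (Fin 2) ℂ}
    (hS : S ∈ pauliGroupOne) : onQubit i S ∈ pauliGroup n := by
  refine ⟨_, fun j => ?_, rfl⟩
  by_cases h : j = i
  · subst h; simpa using hS
  · rw [Function.update_of_ne h]; exact mem_pauliGroupOne (by simp)

theorem pauliGroupOne_mul_conjTranspose {A : Matrix (Fin 2) (Fin 2) ℂ} (hA : A ∈ pauliGroupOne) :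
    A * Aᴴ = 1 := by
  obtain ⟨k, P, hP, rfl⟩ := hA
  have h1 : P * Pᴴ = 1 := by
    simp only [Set.mem_insert_iff, Set.mem_singleton_iff] at hP
    rcases hP with rfl | rfl | rfl | rfl
    · simp
    all_goals
      ext i j
      fin_cases i <;> fin_cases j <;>
        simp [pauliX, pauliY, pauliZ, Matrix.mul_apply]
  rw [Matrix.conjTranspose_smul, smul_mul_smul_comm, h1, star_pow, ← mul_pow]
  simp

theorem pauliGroup_mul_conjTranspose {P : Op n} (hP : P ∈ pauliGroup n) : P * Pᴴ = 1 := by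
  obtain ⟨M, hM, rfl⟩ := hP
  simp only [tensor_conjTranspose, tensor_mul_tensor, pauliGroupOne_mul_conjTranspose (hM _),
    tensor_one]

theorem mul_self_of_isHermitian {P : Op n} (hP : P ∈ pauliGroup n) (h : P.IsHermitian) :
    P * P = 1 := by
  simpa only [h.eq] using pauliGroup_mul_conjTranspose hP

theorem pauliGroupOne_commute_or {A S : Matrix (Fin 2) (Fin 2) ℂ} (hA : A ∈ pauliGroupOne)
    (hS : S = pauliX ∨ S = pauliZ) : A * S = S * A ∨ A * S = -(S * A) := by
  obtain ⟨k, P, hP, rfl⟩ := hA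
  have h1 : P * S = S * P ∨ P * S = -(S * P) := by
    have hXY : pauliX * pauliY = -(pauliY * pauliX) := by
      ext i j; fin_cases i <;> fin_cases j <;> simp [pauliX, pauliY]
    have hYZ : pauliY * pauliZ = -(pauliZ * pauliY) := by
      ext i j; fin_cases i <;> fin_cases j <;> simp [pauliY, pauliZ]
    have hXZ : pauliX * pauliZ = -(pauliZ * pauliX) := by
      ext i j; fin_cases i <;> fin_cases j <;> simp [pauliX, pauliZ]
    simp only [Set.mem_insert_iff, Set.mem_singleton_iff] at hP
    rcases hP with rfl | rfl | rfl | rfl <;> rcases hS with rfl | rfl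
    · simp
    · simp
    · simp
    · exact .inr hXZ
    · right; rw [hXY, neg_neg]
    · exact .inr hYZ
    · right; rw [hXZ, neg_neg]
    · simp
  rcases h1 with h1 | h1
  · left; rw [smul_mul_assoc, mul_smul_comm, h1]
  · right; rw [smul_mul_assoc, mul_smul_comm, h1, smul_neg]

theorem tensor_update_neg (M : Fin n → Matrix (Fin 2) (Fin 2) ℂ) (i : Fin n)
    (B : Matrix (Fin 2) (Fin 2) ℂ) :
    tensor (Function.update M i (-B)) = -tensor (Function.update M i B) := by
  ext x y
  simp only [tensor, Matrix.of_apply, Matrix.neg_apply]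
  rw [← Finset.mul_prod_erase _ _ (Finset.mem_univ i),
    ← Finset.mul_prod_erase _ _ (Finset.mem_univ i), Function.update_self, Function.update_self,
    Matrix.neg_apply, neg_mul]
  congr 2
  refine Finset.prod_congr rfl fun j hj => ?_
  rw [Function.update_of_ne (Finset.ne_of_mem_erase hj),
    Function.update_of_ne (Finset.ne_of_mem_erase hj)]

theorem pauliGroup_commute_or {P : Op n} (hP : P ∈ pauliGroup n) (i : Fin n)
    {S : Matrix (Fin 2) (Fin 2) ℂ} (hS : S = pauliX ∨ S = pauliZ) :
    P * onQubit i S = onQubit i S * P ∨ P * onQubit i S = -(onQubit i S * P) := by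
  obtain ⟨M, hM, rfl⟩ := hP
  have hl : tensor M * onQubit i S = tensor (Function.update M i (M i * S)) := by
    rw [onQubit, tensor_mul_tensor]
    congr 1
    funext j
    by_cases h : j = i
    · subst h; simp
    · simp [Function.update_of_ne h]
  have hr : onQubit i S * tensor M = tensor (Function.update M i (S * M i)) := by
    rw [onQubit, tensor_mul_tensor]
    congr 1
    funext j
    by_cases h : j = i
    · subst h; simp
    · simp [Function.update_of_ne h]
  rw [hl, hr]
  rcases pauliGroupOne_commute_or (hM i) hS with h | h
  · left; rw [h]
  · right; rw [h, tensor_update_neg]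

/-! ### Expectation values -/

/-- The expectation value `⟨φ|M|φ⟩`. -/
def expect (φ : (Fin N → Fin 2) → ℂ) (M : Op N) : ℂ := star φ ⬝ᵥ (M *ᵥ φ)

theorem expect_add (φ : (Fin N → Fin 2) → ℂ) (A B : Op N) :
    expect φ (A + B) = expect φ A + expect φ B := by
  simp [expect, Matrix.add_mulVec, dotProduct_add]

theorem expect_sub (φ : (Fin N → Fin 2) → ℂ) (A B : Op N) :
    expect φ (A - B) = expect φ A - expect φ B := by
  simp [expect, Matrix.sub_mulVec, dotProduct_sub]

theorem expect_smul (φ : (Fin N → Fin 2) → ℂ) (c : ℂ) (A : Op N) :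
    expect φ (c • A) = c * expect φ A := by
  simp [expect, Matrix.smul_mulVec, dotProduct_smul]

theorem expect_neg (φ : (Fin N → Fin 2) → ℂ) (A : Op N) : expect φ (-A) = -expect φ A := by
  simp [expect, Matrix.neg_mulVec]

theorem expect_mulVec (φ : (Fin N → Fin 2) → ℂ) (V M : Op N) :
    expect (V *ᵥ φ) M = expect φ (Vᴴ * M * V) := by
  rw [expect, expect, Matrix.star_mulVec, ← Matrix.dotProduct_mulVec, Matrix.mulVec_mulVec,
    Matrix.mulVec_mulVec, Matrix.mul_assoc]

theorem expect_star (φ : (Fin N → Fin 2) → ℂ) (A : Op N) :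
    star (expect φ A) = expect φ Aᴴ := by
  rw [expect, expect, Matrix.star_dotProduct, Matrix.star_mulVec, star_star,
    ← Matrix.dotProduct_mulVec]

theorem expect_conjTranspose_mul_self_nonneg (φ : (Fin N → Fin 2) → ℂ) (A : Op N) :
    0 ≤ expect φ (Aᴴ * A) := by
  have h : expect φ (Aᴴ * A) = star (A *ᵥ φ) ⬝ᵥ (A *ᵥ φ) := by
    rw [expect, Matrix.star_mulVec, ← Matrix.dotProduct_mulVec, Matrix.mulVec_mulVec]
  rw [h]
  exact dotProduct_star_self_nonneg _

theorem trace_ketbra_mul (φ : (Fin N → Fin 2) → ℂ) (M : Op N) :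
    (ketbra φ * M).trace = expect φ M := by
  rw [ketbra, Matrix.trace_mul_comm, Matrix.mul_vecMulVec, Matrix.trace_vecMulVec, expect,
    dotProduct_comm]

theorem mul_ketbra_mul (C : Op N) (φ : (Fin N → Fin 2) → ℂ) :
    C * ketbra φ * Cᴴ = ketbra (C *ᵥ φ) := by
  rw [ketbra, ketbra, Matrix.mul_vecMulVec, Matrix.vecMulVec_mul, Matrix.star_mulVec]

/-- An extremal expectation `a = ±1` of a Hermitian involution forces an eigenvector, as
`‖Aφ - aφ‖² = 2 - 2a² = 0`. -/
theorem mulVec_eq_of_expect_eq {φ : (Fin N → Fin 2) → ℂ} (hφ : expect φ 1 = 1) {A : Op N}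
    (hA : A.IsHermitian) (hA2 : A * A = 1) {a : ℝ} (ha2 : a ^ 2 = 1) (ha : expect φ A = a) :
    A *ᵥ φ = (a : ℂ) • φ := by
  have h0 : expect φ ((A - (a : ℂ) • 1)ᴴ * (A - (a : ℂ) • 1)) = 0 := by
    have : (A - (a : ℂ) • 1)ᴴ * (A - (a : ℂ) • 1) =
        (1 + (a : ℂ) ^ 2) • (1 : Op N) - (2 * a : ℂ) • A := by
      rw [Matrix.conjTranspose_sub, hA.eq, Matrix.conjTranspose_smul, Matrix.conjTranspose_one,
        Complex.star_def, Complex.conj_ofReal, sub_mul, mul_sub, mul_sub, hA2]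
      simp only [mul_smul_comm, smul_mul_assoc, mul_one, one_mul, smul_smul]
      module
    rw [this, expect_sub, expect_smul, expect_smul, hφ, ha]
    have : (a : ℂ) ^ 2 = 1 := by exact_mod_cast ha2
    linear_combination -this
  have h1 : (A - (a : ℂ) • 1) *ᵥ φ = 0 := by
    rw [← dotProduct_star_self_eq_zero, Matrix.star_mulVec, ← h0, expect,
      ← Matrix.mulVec_mulVec, Matrix.dotProduct_mulVec (star φ)]
  rwa [Matrix.sub_mulVec, Matrix.smul_mulVec, Matrix.one_mulVec, sub_eq_zero] at h1

/-- If `φ` is an eigenvector of the involution `A`, then anything anticommuting with `A` has zero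
expectation: `⟨B⟩ = ⟨ABA⟩ = -⟨B⟩`. -/
theorem expect_eq_zero_of_anticommute {φ : (Fin N → Fin 2) → ℂ} (hφ : expect φ 1 = 1)
    {A B : Op N} (hA : A.IsHermitian) (hA2 : A * A = 1) (hAB : A * B = -(B * A)) {a : ℝ}
    (ha2 : a ^ 2 = 1) (ha : expect φ A = a) : expect φ B = 0 := by
  have hv := mulVec_eq_of_expect_eq hφ hA hA2 ha2 ha
  have h1 : expect (A *ᵥ φ) B = expect φ B := by
    rw [hv, expect, Matrix.mulVec_smul, dotProduct_smul, star_smul, smul_dotProduct, expect,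
      smul_smul, Complex.star_def, Complex.conj_ofReal, ← Complex.ofReal_mul, ← sq, ha2]
    simp
  have h2 : expect (A *ᵥ φ) B = -expect φ B := by
    rw [expect_mulVec, hA.eq, hAB, neg_mul, mul_assoc, hA2, mul_one, expect_neg]
  have h3 := h1.symm.trans h2
  exact self_eq_neg.mp h3

/-! ### Clifford operators and stabilizer states -/

theorem clifford_conjTranspose_mul_mul {V : Op N} (hV : V ∈ cliffordGroup N) {Q : Op N}
    (hQ : Q ∈ pauliGroup N) : Vᴴ * Q * V ∈ pauliGroup N := by
  obtain ⟨hU, him⟩ := hV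
  rw [← him] at hQ
  obtain ⟨R, hR, rfl⟩ := hQ
  have hU' : Vᴴ * V = 1 := Matrix.mem_unitaryGroup_iff'.mp hU
  have : Vᴴ * (V * R * Vᴴ) * V = (Vᴴ * V) * R * (Vᴴ * V) := by noncomm_ring
  dsimp only
  rwa [this, hU', one_mul, mul_one]

theorem clifford_mul_mul_conjTranspose {V : Op N} (hV : V ∈ cliffordGroup N) {Q : Op N}
    (hQ : Q ∈ pauliGroup N) : V * Q * Vᴴ ∈ pauliGroup N := by
  rw [← hV.2]
  exact ⟨Q, hQ, rfl⟩

theorem cliffordGroup_mul {V W : Op N} (hV : V ∈ cliffordGroup N) (hW : W ∈ cliffordGroup N) :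
    V * W ∈ cliffordGroup N := by
  refine ⟨mul_mem hV.1 hW.1, ?_⟩
  have : (fun P : Op N => V * W * P * (V * W)ᴴ) =
      (fun P => V * P * Vᴴ) ∘ fun P => W * P * Wᴴ := by
    funext P
    simp only [Function.comp_apply, Matrix.conjTranspose_mul, Matrix.mul_assoc]
  rw [this, Set.image_comp, hW.2, hV.2]

theorem expect_zeroKet (M : Op N) : expect (zeroKet N) M = M (fun _ => 0) (fun _ => 0) := by
  simp [expect, zeroKet]

/-- The expectation of a Pauli operator in `|0^N⟩` is the product of the upper left entries of its
tensor factors. -/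
theorem expect_zeroKet_pauli {Q : Op N} (hQ : Q ∈ pauliGroup N) :
    expect (zeroKet N) Q = 0 ∨ expect (zeroKet N) Q ^ 4 = 1 := by
  obtain ⟨M, hM, rfl⟩ := hQ
  have h1 : ∀ j, M j 0 0 = 0 ∨ M j 0 0 ^ 4 = 1 := by
    intro j
    obtain ⟨l, P, hP, h⟩ := hM j
    have hI : (Complex.I ^ (l : ℕ)) ^ 4 = 1 := by
      rw [← pow_mul, mul_comm, pow_mul, Complex.I_pow_four, one_pow]
    simp only [Set.mem_insert_iff, Set.mem_singleton_iff] at hP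
    rcases hP with rfl | rfl | rfl | rfl
    · right; simpa [h] using hI
    · left; simp [h, pauliX]
    · left; simp [h, pauliY]
    · right; simpa [h, pauliZ] using hI
  rw [expect_zeroKet, tensor, Matrix.of_apply]
  by_cases h : ∃ j, M j 0 0 = 0
  · obtain ⟨j, hj⟩ := h
    exact .inl (Finset.prod_eq_zero (Finset.mem_univ j) hj)
  · right
    rw [← Finset.prod_pow]
    exact Finset.prod_eq_one fun j _ => (h1 j).resolve_left fun h' => h ⟨j, h'⟩

/-- The features of a stabilizer state that matter here: it is a unit vector in which each element
of the Pauli group has expectation `0` or a fourth root of unity. -/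
structure IsStabilizerState (φ : (Fin N → Fin 2) → ℂ) : Prop where
  expect_one : expect φ 1 = 1
  expect_pauli : ∀ Q ∈ pauliGroup N, expect φ Q = 0 ∨ expect φ Q ^ 4 = 1

theorem isStabilizerState_clifford {V : Op N} (hV : V ∈ cliffordGroup N) :
    IsStabilizerState (V *ᵥ zeroKet N) where
  expect_one := by
    rw [expect_mulVec, mul_one, show Vᴴ * V = 1 from Matrix.mem_unitaryGroup_iff'.mp hV.1,
      expect_zeroKet, Matrix.one_apply_eq]
  expect_pauli Q hQ := by
    rw [expect_mulVec]
    exact expect_zeroKet_pauli (clifford_conjTranspose_mul_mul hV hQ)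

theorem IsStabilizerState.expect_hermitian {φ : (Fin N → Fin 2) → ℂ} (hφ : IsStabilizerState φ)
    {Q : Op N} (hQ : Q ∈ pauliGroup N) {z : ℂ} (hz : z ^ 4 = 1) (h : (z • Q).IsHermitian) :
    ∃ r : ℝ, expect φ (z • Q) = r ∧ (r = 0 ∨ r ^ 2 = 1) := by
  have hreal := expect_star φ (z • Q)
  rw [h.eq] at hreal
  obtain ⟨r, hr⟩ := Complex.conj_eq_iff_real.mp hreal
  refine ⟨r, hr, ?_⟩
  rw [expect_smul] at hr
  rcases hφ.expect_pauli Q hQ with h0 | h4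
  · left
    rw [h0, mul_zero] at hr
    exact_mod_cast hr.symm
  · right
    have : (r : ℂ) ^ 4 = 1 := by rw [← hr, mul_pow, hz, h4, one_mul]
    have h4' : r ^ 4 = 1 := by exact_mod_cast this
    nlinarith [sq_nonneg r]

/-! ### Rotated stabilizer states -/

theorem pauliRotation_eq {P : Op N} (hP : P * P = 1) (θ : ℝ) :
    pauliRotation θ P = (Real.cos θ : ℂ) • (1 : Op N) + (Complex.I * Real.sin θ) • P :=
  exp_I_smul_of_mul_self hP θ

/-- Normal form: a circuit with at most one rotation prepares a rotated stabilizer state. The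
Clifford operator `C` following the rotation is moved past it by `C e^{iθP} = e^{iθ CPC†} C`. -/
theorem IsCliffordRotationCircuit.exists_rotation {t : ℕ} {C : Op N}
    (hC : IsCliffordRotationCircuit N t C) (ht : t ≤ 1) :
    ∃ (φ : (Fin N → Fin 2) → ℂ) (P : Op N) (θ : ℝ), IsStabilizerState φ ∧ P ∈ pauliGroup N ∧
      P.IsHermitian ∧ C *ᵥ zeroKet N = pauliRotation θ P *ᵥ φ := by
  cases hC with
  | clifford _ hC =>
    refine ⟨C *ᵥ zeroKet N, 1, 0, isStabilizerState_clifford hC, one_mem_pauliGroup,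
      Matrix.isHermitian_one, ?_⟩
    simp [pauliRotation]
  | rotate t U C P θ hU hP hPh hC =>
    cases hU with
    | rotate => omega
    | clifford _ hU =>
      have hP2 := mul_self_of_isHermitian hP hPh
      have hC1 : Cᴴ * C = 1 := Matrix.mem_unitaryGroup_iff'.mp hC.1
      have hQ := clifford_mul_mul_conjTranspose hC hP
      have hQh : (C * P * Cᴴ).IsHermitian := Matrix.isHermitian_mul_mul_conjTranspose C hPh
      refine ⟨(C * U) *ᵥ zeroKet N, C * P * Cᴴ, θ,
        isStabilizerState_clifford (cliffordGroup_mul hC hU), hQ, hQh, ?_⟩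
      have hcomm : pauliRotation θ (C * P * Cᴴ) * C = C * pauliRotation θ P := by
        rw [pauliRotation_eq hP2, pauliRotation_eq (mul_self_of_isHermitian hQ hQh), add_mul,
          mul_add, smul_mul_assoc, smul_mul_assoc, mul_smul_comm, mul_smul_comm, one_mul, mul_one,
          mul_assoc (C * P), hC1, mul_one]
      rw [Matrix.mulVec_mulVec, ← mul_assoc, hcomm]

theorem pauliRotation_conjTranspose {P : Op N} (hP : P * P = 1) (hPh : P.IsHermitian) (θ : ℝ) :
    (pauliRotation θ P)ᴴ = (Real.cos θ : ℂ) • (1 : Op N) - (Complex.I * Real.sin θ) • P := by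
  rw [pauliRotation_eq hP, Matrix.conjTranspose_add, Matrix.conjTranspose_smul,
    Matrix.conjTranspose_smul, hPh.eq, Matrix.conjTranspose_one, Complex.star_def,
    Complex.conj_ofReal, map_mul, Complex.conj_I, Complex.conj_ofReal, neg_mul, neg_smul,
    sub_eq_add_neg]

theorem expect_pauliRotation_of_commute {P S : Op N} (hP : P * P = 1) (hPh : P.IsHermitian)
    (h : P * S = S * P) (θ : ℝ) (φ : (Fin N → Fin 2) → ℂ) :
    expect (pauliRotation θ P *ᵥ φ) S = expect φ S := by
  rw [expect_mulVec, pauliRotation_conjTranspose hP hPh, pauliRotation_eq hP]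
  congr 1
  have hPSP : P * S * P = S := by rw [h, mul_assoc, hP, mul_one]
  have hcs : (Real.cos θ : ℂ) ^ 2 + (Real.sin θ : ℂ) ^ 2 = 1 := by
    exact_mod_cast Real.cos_sq_add_sin_sq θ
  generalize (Real.cos θ : ℂ) = c at *
  generalize (Real.sin θ : ℂ) = s at *
  simp only [sub_mul, mul_add, smul_mul_assoc, mul_smul_comm, one_mul, mul_one, hPSP, ← h]
  match_scalars
  · linear_combination hcs - s ^ 2 * Complex.I_sq
  · ring

/-- Rotating by `e^{iθP}` an observable `S` that anticommutes with `P` mixes `S` with the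
observable `iPS`. -/
theorem expect_pauliRotation_of_anticommute {P S : Op N} (hP : P * P = 1) (hPh : P.IsHermitian)
    (h : P * S = -(S * P)) (θ : ℝ) (φ : (Fin N → Fin 2) → ℂ) :
    expect (pauliRotation θ P *ᵥ φ) S =
      Real.cos (2 * θ) * expect φ S - Real.sin (2 * θ) * expect φ (Complex.I • (P * S)) := by
  rw [← expect_smul, ← expect_smul, ← expect_sub, expect_mulVec,
    pauliRotation_conjTranspose hP hPh, pauliRotation_eq hP]
  congr 1
  have hPSP : P * S * P = -S := by rw [h, neg_mul, mul_assoc, hP, mul_one]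
  have hSP : S * P = -(P * S) := by rw [h, neg_neg]
  have hcs : (Real.cos θ : ℂ) ^ 2 + (Real.sin θ : ℂ) ^ 2 = 1 := by
    exact_mod_cast Real.cos_sq_add_sin_sq θ
  simp only [Real.cos_two_mul, Real.sin_two_mul, Complex.ofReal_sub, Complex.ofReal_mul,
    Complex.ofReal_pow, Complex.ofReal_ofNat, Complex.ofReal_one]
  generalize (Real.cos θ : ℂ) = c at *
  generalize (Real.sin θ : ℂ) = s at *
  simp only [sub_mul, mul_add, smul_mul_assoc, mul_smul_comm, one_mul, mul_one, hPSP, hSP]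
  match_scalars
  · linear_combination s ^ 2 * Complex.I_sq - hcs
  · ring

/-! ### Pauli observables in stabilizer states -/

/-- The Pauli observables: Hermitian involutions that are an element of the Pauli group up to a
fourth root of unity `z`. The phase makes room for `iPS`, without having to absorb the factor `i`
into one of the tensor factors. -/
structure IsPauliObservable (A : Op N) : Prop where
  isHermitian : A.IsHermitian
  mul_self : A * A = 1
  exists_smul : ∃ z : ℂ, z ^ 4 = 1 ∧ ∃ Q ∈ pauliGroup N, A = z • Q

theorem IsStabilizerState.expect_observable {φ : (Fin N → Fin 2) → ℂ} (hφ : IsStabilizerState φ)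
    {A : Op N} (hA : IsPauliObservable A) : ∃ r : ℝ, expect φ A = r ∧ (r = 0 ∨ r ^ 2 = 1) := by
  obtain ⟨z, hz, Q, hQ, rfl⟩ := hA.exists_smul
  exact hφ.expect_hermitian hQ hz hA.isHermitian

/-- The uncertainty relation for stabilizer states: of two anticommuting observables, at most one
has nonzero expectation. -/
theorem IsStabilizerState.expect_eq_zero_or {φ : (Fin N → Fin 2) → ℂ} (hφ : IsStabilizerState φ)
    {A B : Op N} (hA : IsPauliObservable A) (hAB : A * B = -(B * A)) :
    expect φ A = 0 ∨ expect φ B = 0 := by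
  obtain ⟨r, hr, h | h⟩ := hφ.expect_observable hA
  · left; rw [hr, h, Complex.ofReal_zero]
  · exact .inr (expect_eq_zero_of_anticommute hφ.expect_one hA.isHermitian hA.mul_self hAB h hr)

theorem isPauliObservable_onQubit (a : Fin N) {S : Matrix (Fin 2) (Fin 2) ℂ}
    (hS : S = pauliX ∨ S = pauliZ) : IsPauliObservable (onQubit a S) := by
  have hS1 : S ∈ pauliGroupOne := mem_pauliGroupOne (by rcases hS with rfl | rfl <;> simp)
  have hSh : Sᴴ = S := by
    rcases hS with rfl | rfl <;>
      (ext i j; fin_cases i <;> fin_cases j <;> simp [pauliX, pauliZ])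
  have hm := onQubit_mem_pauliGroup a hS1
  have hh : (onQubit a S).IsHermitian := by
    rw [Matrix.IsHermitian, onQubit_conjTranspose, hSh]
  exact ⟨hh, mul_self_of_isHermitian hm hh, 1, by norm_num, _, hm, (one_smul _ _).symm⟩

theorem isPauliObservable_I_smul_mul {P : Op N} (hP : P ∈ pauliGroup N) (hPh : P.IsHermitian)
    (a : Fin N) {S : Matrix (Fin 2) (Fin 2) ℂ} (hS : S = pauliX ∨ S = pauliZ)
    (h : P * onQubit a S = -(onQubit a S * P)) :
    IsPauliObservable (Complex.I • (P * onQubit a S)) := by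
  have hS1 : S ∈ pauliGroupOne := mem_pauliGroupOne (by rcases hS with rfl | rfl <;> simp)
  have hA := isPauliObservable_onQubit a hS
  refine ⟨?_, ?_, Complex.I, Complex.I_pow_four, _,
    pauliGroup_mul hP (onQubit_mem_pauliGroup a hS1), rfl⟩
  · rw [Matrix.IsHermitian, Matrix.conjTranspose_smul, Matrix.conjTranspose_mul, hPh.eq,
      hA.isHermitian.eq, h, Complex.star_def, Complex.conj_I, neg_smul, smul_neg]
  · rw [smul_mul_smul_comm, Complex.I_mul_I, h, neg_mul_neg, mul_assoc, ← mul_assoc P, h,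
      neg_mul, mul_assoc, mul_self_of_isHermitian hP hPh, mul_one, mul_neg, hA.mul_self]
    simp

theorem onQubit_X_mul_Z (a : Fin N) :
    onQubit a pauliX * onQubit a pauliZ = -(onQubit a pauliZ * onQubit a pauliX) := by
  rw [onQubit_mul, onQubit_mul, ← onQubit_neg]
  congr 1
  ext i j; fin_cases i <;> fin_cases j <;> simp [pauliX, pauliZ]

/-- `S_a` anticommutes with `iPT_b` whenever it anticommutes with `P`, as `T_b` sits on another
qubit. -/
theorem onQubit_mul_I_smul_mul {P : Op N} {a b : Fin N} (hab : a ≠ b)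
    {S T : Matrix (Fin 2) (Fin 2) ℂ} (h : P * onQubit a S = -(onQubit a S * P)) :
    onQubit a S * (Complex.I • (P * onQubit b T)) =
      -((Complex.I • (P * onQubit b T)) * onQubit a S) := by
  have h' : onQubit a S * P = -(P * onQubit a S) := by rw [h, neg_neg]
  rw [mul_smul_comm, smul_mul_assoc, ← smul_neg, ← mul_assoc, h', neg_mul, mul_assoc, mul_assoc,
    (onQubit_commute hab S T).eq]

/-! ### Qubits of low energy -/

theorem abs_mul_sub_mul_le_one {u v c s : ℝ} (hc : c ^ 2 ≤ 1) (hs : s ^ 2 ≤ 1)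
    (hu : u = 0 ∨ u ^ 2 = 1) (hv : v = 0 ∨ v ^ 2 = 1) (h : u = 0 ∨ v = 0) :
    |c * u - s * v| ≤ 1 := by
  rw [← sq_le_one_iff_abs_le_one]
  rcases h with rfl | rfl
  · rcases hv with rfl | hv
    · norm_num
    · rwa [mul_zero, zero_sub, neg_sq, mul_pow, hv, mul_one]
  · rcases hu with rfl | hu
    · norm_num
    · rwa [mul_zero, sub_zero, mul_pow, hu, mul_one]

/-- In a rotated stabilizer state, a qubit with `⟨Z_a⟩ - ⟨X_a⟩ > 1`, which no stabilizer state
allows, must be rotated in the `XZ`-plane by `P`, and both `{⟨X_a⟩, ⟨Z_a⟩}` and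
`{⟨iPX_a⟩, ⟨iPZ_a⟩}`, taken in the stabilizer state before the rotation, must contain a nonzero
value. -/
theorem exists_anticommuting_of_one_lt {φ : (Fin N → Fin 2) → ℂ} (hφ : IsStabilizerState φ) {P : Op N}
    (hP : P ∈ pauliGroup N) (hPh : P.IsHermitian) (θ : ℝ) (a : Fin N)
    (hbad : 1 < (expect (pauliRotation θ P *ᵥ φ) (onQubit a pauliZ)).re -
      (expect (pauliRotation θ P *ᵥ φ) (onQubit a pauliX)).re) :
    (∃ S, (S = pauliX ∨ S = pauliZ) ∧ P * onQubit a S = -(onQubit a S * P) ∧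
      expect φ (onQubit a S) ≠ 0) ∧
    ∃ T, (T = pauliX ∨ T = pauliZ) ∧ P * onQubit a T = -(onQubit a T * P) ∧
      expect φ (Complex.I • (P * onQubit a T)) ≠ 0 := by
  have hP2 := mul_self_of_isHermitian hP hPh
  have hX : pauliX = pauliX ∨ pauliX = pauliZ := .inl rfl
  have hZ : pauliZ = pauliX ∨ pauliZ = pauliZ := .inr rfl
  have oX := isPauliObservable_onQubit a hX
  have oZ := isPauliObservable_onQubit a hZ
  have hXZ := onQubit_X_mul_Z a
  obtain ⟨u, hu, hu1⟩ := hφ.expect_observable oX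
  obtain ⟨w, hw, hw1⟩ := hφ.expect_observable oZ
  have huw : u = 0 ∨ w = 0 := by
    simpa [hu, hw] using hφ.expect_eq_zero_or oX hXZ
  have hc := Real.cos_sq_le_one (2 * θ)
  have hs := Real.sin_sq_le_one (2 * θ)
  have le_one : ∀ r : ℝ, (r = 0 ∨ r ^ 2 = 1) → |r| ≤ 1 := by
    rintro r (rfl | h)
    · norm_num
    · rw [← sq_le_one_iff_abs_le_one, h]
  have self_anticommute : ∀ S : Op N, P * S = -(S * P) →
      S * (Complex.I • (P * S)) = -((Complex.I • (P * S)) * S) := by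
    intro S h
    have h' : S * P = -(P * S) := by rw [h, neg_neg]
    rw [mul_smul_comm, smul_mul_assoc, ← smul_neg, ← mul_assoc, h', neg_mul]
  -- Unless `P` anticommutes with both `X_a` and `Z_a`, one of `⟨X_a⟩`, `⟨Z_a⟩` vanishes in the
  -- rotated state.
  rcases pauliGroup_commute_or hP a hX with cX | cX <;>
    rcases pauliGroup_commute_or hP a hZ with cZ | cZ
  · rw [expect_pauliRotation_of_commute hP2 hPh cX, expect_pauliRotation_of_commute hP2 hPh cZ,
      hu, hw, Complex.ofReal_re, Complex.ofReal_re] at hbad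
    exfalso
    rcases huw with rfl | rfl
    · linarith [(abs_le.mp (le_one w hw1)).2]
    · linarith [(abs_le.mp (le_one u hu1)).1]
  · obtain ⟨w', hw', hw1'⟩ := hφ.expect_observable (isPauliObservable_I_smul_mul hP hPh a hZ cZ)
    have hww : w = 0 ∨ w' = 0 := by
      simpa [hw, hw'] using hφ.expect_eq_zero_or oZ (self_anticommute _ cZ)
    have huw' : u = 0 ∨ w' = 0 := by
      refine (hφ.expect_eq_zero_or oX (B := Complex.I • (P * onQubit a pauliZ)) ?_).imp
        (by simp [hu]) (by simp [hw'])
      rw [mul_smul_comm, smul_mul_assoc, ← smul_neg, ← mul_assoc, ← cX, mul_assoc, hXZ, mul_neg,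
        mul_assoc]
    rw [expect_pauliRotation_of_commute hP2 hPh cX, expect_pauliRotation_of_anticommute hP2 hPh cZ,
      hu, hw, hw'] at hbad
    exfalso
    norm_cast at hbad
    have hb := (abs_le.mp (abs_mul_sub_mul_le_one hc hs hw1 hw1' hww)).2
    by_cases h0 : u = 0
    · rw [h0] at hbad; linarith
    · rw [huw.resolve_left h0, huw'.resolve_left h0] at hbad
      linarith [(abs_le.mp (le_one u hu1)).1]
  · obtain ⟨u', hu', hu1'⟩ := hφ.expect_observable (isPauliObservable_I_smul_mul hP hPh a hX cX)
    have huu : u = 0 ∨ u' = 0 := by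
      simpa [hu, hu'] using hφ.expect_eq_zero_or oX (self_anticommute _ cX)
    have hwu' : w = 0 ∨ u' = 0 := by
      refine (hφ.expect_eq_zero_or oZ (B := Complex.I • (P * onQubit a pauliX)) ?_).imp
        (by simp [hw]) (by simp [hu'])
      rw [mul_smul_comm, smul_mul_assoc, ← smul_neg, ← mul_assoc, ← cZ, mul_assoc, mul_assoc, hXZ,
        mul_neg, neg_neg]
    rw [expect_pauliRotation_of_anticommute hP2 hPh cX, expect_pauliRotation_of_commute hP2 hPh cZ,
      hu, hw, hu'] at hbad
    exfalso
    norm_cast at hbad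
    have hb := (abs_le.mp (abs_mul_sub_mul_le_one hc hs hu1 hu1' huu)).1
    by_cases h0 : w = 0
    · rw [h0] at hbad; linarith
    · rw [huw.resolve_right h0, hwu'.resolve_left h0] at hbad
      linarith [(abs_le.mp (le_one w hw1)).2]
  · have oX' := isPauliObservable_I_smul_mul hP hPh a hX cX
    obtain ⟨u', hu', hu1'⟩ := hφ.expect_observable oX'
    obtain ⟨w', hw', hw1'⟩ := hφ.expect_observable (isPauliObservable_I_smul_mul hP hPh a hZ cZ)
    have huw' : u' = 0 ∨ w' = 0 := by
      refine (hφ.expect_eq_zero_or oX' (B := Complex.I • (P * onQubit a pauliZ)) ?_).imp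
        (by simp [hu']) (by simp [hw'])
      have e1 : ∀ S T : Op N, P * S = -(S * P) → P * S * (P * T) = -(S * T) := by
        intro S T h
        rw [h, neg_mul, mul_assoc, ← mul_assoc P, hP2, one_mul]
      rw [smul_mul_smul_comm, smul_mul_smul_comm, e1 _ _ cX, e1 _ _ cZ, hXZ, smul_neg, smul_neg]
    rw [expect_pauliRotation_of_anticommute hP2 hPh cX,
      expect_pauliRotation_of_anticommute hP2 hPh cZ, hu, hw, hu', hw'] at hbad
    norm_cast at hbad
    constructor
    · by_contra! hno
      have hu0 : u = 0 := by simpa [hu] using hno _ hX cX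
      have hw0 : w = 0 := by simpa [hw] using hno _ hZ cZ
      have := abs_le.mp (abs_mul_sub_mul_le_one hs hs hu1' hw1' huw')
      rw [hu0, hw0] at hbad
      linarith
    · by_contra! hno
      have hu0 : u' = 0 := by simpa [hu'] using hno _ hX cX
      have hw0 : w' = 0 := by simpa [hw'] using hno _ hZ cZ
      rw [hu0, hw0] at hbad
      have := abs_le.mp (abs_mul_sub_mul_le_one hc hc hw1 hu1 huw.symm)
      linarith

/-- At most one qubit of a rotated stabilizer state has `⟨Z_a⟩ - ⟨X_a⟩ > 1`: for two such qubits,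
an observable `S_a` and an observable `iPT_b` would both have nonzero expectation in a stabilizer
state although they anticommute. -/
theorem eq_of_one_lt_of_one_lt {φ : (Fin N → Fin 2) → ℂ} (hφ : IsStabilizerState φ) {P : Op N}
    (hP : P ∈ pauliGroup N) (hPh : P.IsHermitian) (θ : ℝ) {a b : Fin N}
    (ha : 1 < (expect (pauliRotation θ P *ᵥ φ) (onQubit a pauliZ)).re -
      (expect (pauliRotation θ P *ᵥ φ) (onQubit a pauliX)).re)
    (hb : 1 < (expect (pauliRotation θ P *ᵥ φ) (onQubit b pauliZ)).re -
      (expect (pauliRotation θ P *ᵥ φ) (onQubit b pauliX)).re) : a = b := by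
  by_contra hab
  obtain ⟨⟨S, hS, cS, hS0⟩, -⟩ := exists_anticommuting_of_one_lt hφ hP hPh θ a ha
  obtain ⟨-, T, hT, cT, hT0⟩ := exists_anticommuting_of_one_lt hφ hP hPh θ b hb
  exact (hφ.expect_eq_zero_or (isPauliObservable_onQubit a hS)
    (onQubit_mul_I_smul_mul hab cS)).elim hS0 hT0

/-! ### The rotated zero Hamiltonian -/

/-- The projector `D†|1⟩⟨1|D`, the local term of the rotated zero Hamiltonian. -/
def rotatedProj : Matrix (Fin 2) (Fin 2) ℂ := gateDᴴ * projOne * gateD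

theorem gateD_eq : gateD = !![(Real.cos (Real.pi / 8) : ℂ), -(Real.sin (Real.pi / 8) : ℂ);
    (Real.sin (Real.pi / 8) : ℂ), (Real.cos (Real.pi / 8) : ℂ)] := by
  have hY : pauliY * pauliY = 1 := by
    ext i j; fin_cases i <;> fin_cases j <;> simp [pauliY]
  have h : -(Complex.I * ((Real.pi / 8 : ℝ) : ℂ)) = Complex.I * ((-(Real.pi / 8) : ℝ) : ℂ) := by
    push_cast; ring
  rw [gateD, h, exp_I_smul_of_mul_self hY, Real.cos_neg, Real.sin_neg]
  generalize Real.cos (Real.pi / 8) = c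
  generalize Real.sin (Real.pi / 8) = s
  have hI : Complex.I * s * Complex.I = -s := by
    linear_combination (s : ℂ) * Complex.I_sq
  ext i j; fin_cases i <;> fin_cases j <;> simp [pauliY, hI]

theorem rotatedProj_eq : rotatedProj = ((1 / 2 : ℝ) : ℂ) • (1 : Matrix (Fin 2) (Fin 2) ℂ) +
    ((√2 / 4 : ℝ) : ℂ) • (pauliX - pauliZ) := by
  have hs : Real.sin (Real.pi / 8) * Real.sin (Real.pi / 8) = 1 / 2 - √2 / 4 := by
    have h := Real.sin_sq_eq_half_sub (Real.pi / 8)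
    rw [show 2 * (Real.pi / 8) = Real.pi / 4 by ring, Real.cos_pi_div_four] at h
    linarith
  have hc : Real.cos (Real.pi / 8) * Real.cos (Real.pi / 8) = 1 / 2 + √2 / 4 := by
    linarith [Real.sin_sq_add_cos_sq (Real.pi / 8)]
  have hsc : Real.sin (Real.pi / 8) * Real.cos (Real.pi / 8) = √2 / 4 := by
    have h := Real.sin_two_mul (Real.pi / 8)
    rw [show 2 * (Real.pi / 8) = Real.pi / 4 by ring, Real.sin_pi_div_four] at h
    linarith
  rw [rotatedProj, gateD_eq]
  generalize Real.cos (Real.pi / 8) = c at *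
  generalize Real.sin (Real.pi / 8) = s at *
  have hs' : (s : ℂ) * s = 1 / 2 - ((√2 : ℝ) : ℂ) / 4 := by
    rw [← Complex.ofReal_mul, hs]; push_cast; rfl
  have hc' : (c : ℂ) * c = 1 / 2 + ((√2 : ℝ) : ℂ) / 4 := by
    rw [← Complex.ofReal_mul, hc]; push_cast; rfl
  have hsc' : (s : ℂ) * c = ((√2 : ℝ) : ℂ) / 4 := by
    rw [← Complex.ofReal_mul, hsc]; push_cast; rfl
  have hcs' : (c : ℂ) * s = ((√2 : ℝ) : ℂ) / 4 := by rw [mul_comm, hsc']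
  ext i j
  fin_cases i <;> fin_cases j <;>
    simp [projOne, pauliX, pauliZ, Matrix.mul_apply, hs', hc', hsc', hcs'] <;> ring

theorem sin_sq_pi_div_eight : Real.sin (Real.pi / 8) ^ 2 = 1 / 2 - √2 / 4 := by
  rw [Real.sin_sq_eq_half_sub, show 2 * (Real.pi / 8) = Real.pi / 4 by ring,
    Real.cos_pi_div_four]
  ring

/-- By `D†|1⟩⟨1|D = (1 + (X - Z)/√2)/2`, the local energy falls below `sin²(π/8) = (1 - 1/√2)/2`
exactly if `⟨Z_a⟩ - ⟨X_a⟩ > 1`. -/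
theorem expect_onQubit_rotatedProj {χ : (Fin N → Fin 2) → ℂ} (hχ : expect χ 1 = 1) (a : Fin N) :
    (expect χ (onQubit a rotatedProj)).re = 1 / 2 - √2 / 4 *
      ((expect χ (onQubit a pauliZ)).re - (expect χ (onQubit a pauliX)).re) := by
  rw [rotatedProj_eq, onQubit_add, onQubit_smul, onQubit_smul, sub_eq_add_neg pauliX, onQubit_add,
    onQubit_neg, onQubit_one, expect_add, expect_smul, expect_smul, expect_add, expect_neg, hχ,
    mul_one, Complex.add_re, Complex.re_ofReal_mul, Complex.ofReal_re, Complex.add_re,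
    Complex.neg_re]
  ring

theorem expect_onQubit_rotatedProj_nonneg (χ : (Fin N → Fin 2) → ℂ) (a : Fin N) :
    0 ≤ (expect χ (onQubit a rotatedProj)).re := by
  have h : rotatedProj = (projOne * gateD)ᴴ * (projOne * gateD) := by
    have h1 : projOneᴴ * projOne = projOne := by
      ext i j; fin_cases i <;> fin_cases j <;> simp [projOne, Matrix.mul_apply]
    rw [Matrix.conjTranspose_mul, Matrix.mul_assoc, ← Matrix.mul_assoc projOneᴴ, h1,
      ← Matrix.mul_assoc, rotatedProj]
  rw [h, ← onQubit_mul, ← onQubit_conjTranspose]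
  exact (Complex.le_def.mp (expect_conjTranspose_mul_self_nonneg χ _)).1

theorem energy_eq (ρ : Op n) :
    energy ρ = 1 / (n : ℝ) * ∑ i, (ρ * onQubit i rotatedProj).trace.re := by
  have h : (1 / (n : ℂ)) = ((1 / n : ℝ) : ℂ) := by push_cast; rfl
  rw [energy, rotatedZeroHamiltonian, h, Matrix.mul_smul, Matrix.trace_smul, smul_eq_mul,
    Complex.re_ofReal_mul, Finset.mul_sum, Matrix.trace_sum, Complex.re_sum]
  rfl

theorem energy_qubitState (i : Fin n) (ρ : Op n) :
    energy (qubitState i ρ) = (ρ * onQubit i rotatedProj).trace.re := by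
  rw [energy_eq]
  simp only [qubitState, trace_reducedState_mul_onQubit, Finset.univ_unique, Finset.sum_singleton,
    Nat.cast_one, div_one, one_mul]
  rfl

theorem energy_ketbra (ψ : (Fin n → Fin 2) → ℂ) :
    energy (ketbra ψ) = (star ψ ⬝ᵥ (rotatedZeroHamiltonian n *ᵥ ψ)).re := by
  rw [energy, trace_ketbra_mul, expect]

theorem sub_one_mul_le_sum {f : Fin n → ℝ} {b : ℝ} (hb0 : 0 ≤ b) (h0 : ∀ i, 0 ≤ f i)
    (h : ∀ i j, f i < b → f j < b → i = j) : ((n : ℝ) - 1) * b ≤ ∑ i, f i := by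
  by_cases hb : ∃ i, f i < b
  · obtain ⟨i, hi⟩ := hb
    have hn : 1 ≤ n := Fin.pos i
    rw [← Finset.add_sum_erase _ _ (Finset.mem_univ i)]
    have h1 : (Finset.univ.erase i).card • b ≤ ∑ j ∈ Finset.univ.erase i, f j :=
      Finset.card_nsmul_le_sum _ _ _ fun j hj => not_lt.mp fun hlt =>
        Finset.ne_of_mem_erase hj (h j i hlt hi)
    rw [Finset.card_erase_of_mem (Finset.mem_univ i), Finset.card_univ, Fintype.card_fin,
      nsmul_eq_mul, Nat.cast_sub hn, Nat.cast_one] at h1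
    linarith [h0 i]
  · push Not at hb
    have h1 := Finset.card_nsmul_le_sum Finset.univ f b fun i _ => hb i
    rw [Finset.card_univ, Fintype.card_fin, nsmul_eq_mul] at h1
    linarith

end Clifford

end

theorem lemmaB9 (n N t : ℕ) (hn : 1 ≤ n) (ht : t ≤ 1) (C : Clifford.Op N)
    (hC : Clifford.IsCliffordRotationCircuit N t C) (e : Fin n ↪ Fin N) :
    (∀ ψ : (Fin n → Fin 2) → ℂ, Clifford.Prepares e C (Clifford.ketbra ψ) →
      (1 - 1 / (n : ℝ)) * Real.sin (Real.pi / 8) ^ 2 ≤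
        (star ψ ⬝ᵥ (Clifford.rotatedZeroHamiltonian n *ᵥ ψ)).re) ∧
    (∀ ρ : Clifford.Op n, Clifford.Prepares e C ρ →
      (1 - 1 / (n : ℝ)) * Real.sin (Real.pi / 8) ^ 2 ≤ Clifford.energy ρ ∧
      ∀ i j : Fin n,
        Clifford.energy (Clifford.qubitState i ρ) < Real.sin (Real.pi / 8) ^ 2 →
        Clifford.energy (Clifford.qubitState j ρ) < Real.sin (Real.pi / 8) ^ 2 → i = j) := by
  open Clifford in
  have main : ∀ ρ : Op n, Prepares e C ρ →
      (1 - 1 / (n : ℝ)) * Real.sin (Real.pi / 8) ^ 2 ≤ energy ρ ∧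
      ∀ i j : Fin n, energy (qubitState i ρ) < Real.sin (Real.pi / 8) ^ 2 →
        energy (qubitState j ρ) < Real.sin (Real.pi / 8) ^ 2 → i = j := by
    intro ρ hρ
    obtain ⟨φ, P, θ, hφ, hP, hPh, hCφ⟩ := hC.exists_rotation ht
    have htrace : ∀ i, (ρ * onQubit i rotatedProj).trace =
        expect (pauliRotation θ P *ᵥ φ) (onQubit (e i) rotatedProj) := by
      intro i
      rw [hρ, mul_ketbra_mul, trace_reducedState_mul_onQubit, hCφ, trace_ketbra_mul]
    have hnorm : expect (pauliRotation θ P *ᵥ φ) 1 = 1 := by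
      rw [expect_pauliRotation_of_commute (mul_self_of_isHermitian hP hPh) hPh (by simp),
        hφ.expect_one]
    have hlow : ∀ i, (ρ * onQubit i rotatedProj).trace.re < Real.sin (Real.pi / 8) ^ 2 →
        1 < (expect (pauliRotation θ P *ᵥ φ) (onQubit (e i) pauliZ)).re -
          (expect (pauliRotation θ P *ᵥ φ) (onQubit (e i) pauliX)).re := by
      intro i hi
      rw [htrace, expect_onQubit_rotatedProj hnorm, sin_sq_pi_div_eight] at hi
      have h2 : (0 : ℝ) < √2 / 4 := by positivity
      exact lt_of_mul_lt_mul_left (by linarith) h2.le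
    have huniq : ∀ i j, (ρ * onQubit i rotatedProj).trace.re < Real.sin (Real.pi / 8) ^ 2 →
        (ρ * onQubit j rotatedProj).trace.re < Real.sin (Real.pi / 8) ^ 2 → i = j :=
      fun i j hi hj => e.injective (eq_of_one_lt_of_one_lt hφ hP hPh θ (hlow i hi) (hlow j hj))
    refine ⟨?_, fun i j hi hj => huniq i j ?_ ?_⟩
    · have hsum := sub_one_mul_le_sum (sq_nonneg _) (fun i => by
        rw [htrace]; exact expect_onQubit_rotatedProj_nonneg _ _) huniq
      have hn0 : (0 : ℝ) < n := by exact_mod_cast hn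
      rw [energy_eq]
      calc (1 - 1 / (n : ℝ)) * Real.sin (Real.pi / 8) ^ 2
          = 1 / (n : ℝ) * (((n : ℝ) - 1) * Real.sin (Real.pi / 8) ^ 2) := by field_simp
        _ ≤ _ := mul_le_mul_of_nonneg_left hsum (by positivity)
    · rwa [← energy_qubitState]
    · rwa [← energy_qubitState]
  refine ⟨fun ψ hψ => ?_, main⟩
  rw [← Clifford.energy_ketbra]
  exact (main _ hψ).1
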